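/- \textbf{Theorem (Leray type homology spectral sequence).} For a simplicial set $X$ let $\Delta/X$ be its category of simplices: its objects are the simplices of $X$, and its morphisms $x\to x'$ are the morphisms $\theta$ of $\Delta$ with $x=X(\theta)(x')$. A map $f\colon X\to Y$ induces a functor $\Delta/f\colon\Delta/X\to\Delta/Y$, $x\mapsto f(x)$. Let $\mathscr A$ be a cocomplete abelian category with exact coproducts. For a functor $T\colon(\Delta/X)^{op}\to\mathscr A$ (a contravariant Gabriel--Zisman natural system on $X$), the Gabriel--Zisman homology $H^{GZ}_n(X,T)$ is the $n$-th homology of the chain complex $C_n=\bigoplus_{\sigma\in X_n}T(\sigma)$ whose differential $C_{n+1}\to C_n$ is $\sum_{i=0}^{n+1}(-1)^i(\delta^i)^{\#}$, where $(\delta^i)^{\#}\colon T(\sigma)\to T(\sigma\circ\delta^i)$ is induced by the $i$-th coface map. It is functorial in pairs $(\varphi,\tau)\colon(X,T)\to(X',T')$ with $\varphi\colon X\to X'$ a simplicial map and $\tau\colon T\to T'\circ(\Delta/\varphi)^{op}$ a natural transformation. Let $f\colon X\to Y$ be a map of simplicial sets and let $Lan^{(\Delta/f)^{op}}\colon \mathrm{Fun}((\Delta/X)^{op},\mathscr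 A)\to\mathrm{Fun}((\Delta/Y)^{op},\mathscr A)$ be the left Kan extension functor along $(\Delta/f)^{op}$. Then its left satellites $L_q((\Delta/f)^{op})_*$, $q\ge 0$, exist; that is, there is a universal homological $\partial$-functor whose degree-$0$ part is $Lan^{(\Delta/f)^{op}}$. For every $T\colon(\Delta/X)^{op}\to\mathscr A$ there is a first quadrant homology spectral sequence $(E^r_{p,q})_{r\ge 2}$, with differentials $d^r\colon E^r_{p,q}\to E^r_{p-r,q+r-1}$, $$E^2_{p,q}\cong H^{GZ}_p\bigl(Y,\,(L_q((\Delta/f)^{op})_*)(T)\bigr)\Longrightarrow H^{GZ}_{p+q}(X,T).$$ Here convergence means that $H^{GZ}_n(X,T)$ has a filtration $0=F_{-1}\subseteq F_0\subseteq\dots\subseteq F_n=H^{GZ}_n(X,T)$ with $F_p/F_{p-1}\cong E^\infty_{p,n-p}$. The spectral sequence is natural in $f$ and $T$: it is a functor on the category whose objects are the pairs $(f\colon X\to Y,\,T)$ and whose morphisms $(f,T)\to(f',T')$ are triples of maps $g\colon X\to X'$, $h\colon Y\to Y'$ with $f'g=hf$ and a natural transformation $\tau\colon T\to T'\circ(\Delta/g)^{op}$.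 The canonical transformation $Lan^{(\Delta/f)^{op}}(S\circ(\Delta/g)^{op})\to Lan^{(\Delta/f')^{op}}(S)\circ(\Delta/h)^{op}$, natural in $S\colon(\Delta/X')^{op}\to\mathscr A$, extends uniquely to a morphism of $\partial$-functors between the satellites, and the isomorphism of the $E^2$-terms is natural with respect to the maps on $H^{GZ}_p$ induced by $h$, $\tau$ and this morphism. The filtrations and the isomorphisms $F_p/F_{p-1}\cong E^\infty_{p,n-p}$ are natural with respect to the maps $H^{GZ}_n(X,T)\to H^{GZ}_n(X',T')$ induced by $(g,\tau)$. -/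

import Mathlib

open CategoryTheory CategoryTheory.Limits

universe w v u

/-! ### Contravariant Gabriel-Zisman natural systems -/

namespace GabrielZisman

/-- The opposite `(Δ/X)ᵒᵖ` of the category of simplices of a simplicial set `X`.  Its objects are
the simplices `x` of `X`; a morphism `x ⟶ x'` is a morphism `θ` of `Δᵒᵖ` with `X(θ)(x) = x'`. -/
abbrev OpSimplices (X : SSet.{u}) : Type u := X.Elements

/-- The functor `(Δ/f)ᵒᵖ : (Δ/X)ᵒᵖ ⥤ (Δ/Y)ᵒᵖ`, `x ↦ f x`, induced by a map `f : X ⟶ Y`. -/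
abbrev opSimplicesMap {X Y : SSet.{u}} (f : X ⟶ Y) : OpSimplices X ⥤ OpSimplices Y :=
  CategoryOfElements.map f

/-- A contravariant Gabriel-Zisman natural system: a simplicial set `X` together with a functor
`T : (Δ/X)ᵒᵖ ⥤ A`. -/
structure NatSystem (A : Type w) [Category.{v} A] where
  /-- the simplicial set -/
  X : SSet.{u}
  /-- the coefficient system -/
  T : OpSimplices X ⥤ A

namespace NatSystem

variable {A : Type w} [Category.{v} A]

/-- A morphism `(φ, τ) : (X, T_X) ⟶ (Y, T_Y)` is a simplicial map `φ : X ⟶ Y` with a natural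
transformation `τ : T_X ⟶ T_Y ∘ (Δ/φ)ᵒᵖ`. -/
@[ext]
structure Hom (S S' : NatSystem.{w, v, u} A) where
  /-- the map of simplicial sets -/
  φ : S.X ⟶ S'.X
  /-- the natural transformation of coefficient systems -/
  τ : S.T ⟶ opSimplicesMap φ ⋙ S'.T

instance : Category (NatSystem.{w, v, u} A) where
  Hom := Hom
  id S := ⟨𝟙 S.X, 𝟙 S.T⟩
  comp a b := ⟨a.φ ≫ b.φ, a.τ ≫ Functor.whiskerLeft (opSimplicesMap a.φ) b.τ⟩
  id_comp a := by
    refine Hom.ext (Category.id_comp _) (heq_of_eq ?_)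
    ext x
    exact Category.id_comp _
  comp_id a := by
    refine Hom.ext (Category.comp_id _) (heq_of_eq ?_)
    ext x
    exact Category.comp_id _
  assoc a b c := by
    refine Hom.ext (Category.assoc _ _ _) (heq_of_eq ?_)
    ext x
    exact Category.assoc _ _ _

variable (A) in
/-- The functor that sends a natural system `(X, T)` to the simplicial set `X`. -/
def toSSet : NatSystem.{w, v, u} A ⥤ SSet.{u} where
  obj S := S.X
  map a := a.φ

end NatSystem

/-! ### The Gabriel-Zisman chain complex and its homology -/

section Homology

variable {A : Type w} [Category.{v} A] [HasCoproducts.{u} A]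

/-- The map `T(σ) ⟶ ⨁_{ρ ∈ X_m} T(ρ)` that an operator `θ` with `X(θ)(σ) = ρ` induces. -/
noncomputable def summandMap (S : NatSystem.{w, v, u} A) {n m : SimplexCategoryᵒᵖ} (θ : n ⟶ m)
    (σ : S.X.obj n) (ρ : S.X.obj m) (h : S.X.map θ σ = ρ) :
    S.T.obj (S.X.elementsMk n σ) ⟶ ∐ fun ρ : S.X.obj m => S.T.obj (S.X.elementsMk m ρ) :=
  S.T.map (CategoryOfElements.homMk (S.X.elementsMk n σ) (S.X.elementsMk m ρ) θ h) ≫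
    Sigma.ι (fun ρ : S.X.obj m => S.T.obj (S.X.elementsMk m ρ)) ρ

theorem summandMap_congr (S : NatSystem.{w, v, u} A) {n m : SimplexCategoryᵒᵖ} (θ : n ⟶ m)
    (σ : S.X.obj n) (ρ ρ' : S.X.obj m) (h : S.X.map θ σ = ρ) (h' : S.X.map θ σ = ρ') :
    summandMap S θ σ ρ h = summandMap S θ σ ρ' h' := by
  subst h; subst h'; rfl

/-- The simplicial object `[n] ↦ ⨁_{σ ∈ X_n} T(σ)`; an operator `θ` maps the summand `T(σ)` to the
summand `T(X(θ)(σ))` by the map that `T` induces. -/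
noncomputable def simplicialReplacement (S : NatSystem.{w, v, u} A) : SimplicialObject A where
  obj n := ∐ fun σ : S.X.obj n => S.T.obj (S.X.elementsMk n σ)
  map {n m} θ := Sigma.desc fun σ => summandMap S θ σ (S.X.map θ σ) rfl
  map_id n := by
    refine Sigma.hom_ext _ _ fun σ => ?_
    rw [Sigma.ι_desc, summandMap_congr S (𝟙 n) σ _ σ rfl (by simp)]
    refine (congrArg (· ≫ _) (S.T.map_id _)).trans ?_
    simp
  map_comp {n m k} θ η := by
    refine Sigma.hom_ext _ _ fun σ => ?_
    rw [Sigma.ι_desc, Sigma.ι_desc_assoc,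
      summandMap_congr S (θ ≫ η) σ _ (S.X.map η (S.X.map θ σ)) rfl (by simp)]
    simp only [summandMap, Category.assoc, Sigma.ι_desc]
    rw [← Category.assoc, ← S.T.map_comp]
    rfl

/-- The component `τ_σ : T_X(σ) ⟶ T_Y(φ σ)` of a morphism of natural systems. -/
def NatSystem.Hom.at {S S' : NatSystem.{w, v, u} A} (a : S ⟶ S') {n : SimplexCategoryᵒᵖ}
    (σ : S.X.obj n) :
    S.T.obj (S.X.elementsMk n σ) ⟶ S'.T.obj (S'.X.elementsMk n (a.φ.app n σ)) :=
  a.τ.app (S.X.elementsMk n σ)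

/-- The functoriality of the simplicial replacement: `(φ, τ)` maps the summand `T_X(σ)` to the
summand `T_Y(φ σ)` by `τ_σ`. -/
noncomputable def simplicialReplacementMap {S S' : NatSystem.{w, v, u} A} (a : S ⟶ S') :
    simplicialReplacement S ⟶ simplicialReplacement S' where
  app n := Sigma.desc fun σ : S.X.obj n => NatSystem.Hom.at a σ ≫
    Sigma.ι (fun ρ : S'.X.obj n => S'.T.obj (S'.X.elementsMk n ρ)) (a.φ.app n σ)
  naturality n m θ := by
    refine Sigma.hom_ext _ _ fun σ => ?_
    have e : S'.X.map θ (a.φ.app n σ) = a.φ.app m (S.X.map θ σ) :=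
      (NatTrans.naturality_apply a.φ θ σ).symm
    have key : S.T.map (CategoryOfElements.homMk (S.X.elementsMk n σ)
        (S.X.elementsMk m (S.X.map θ σ)) θ rfl) ≫ NatSystem.Hom.at a (S.X.map θ σ) =
        NatSystem.Hom.at a σ ≫ S'.T.map (CategoryOfElements.homMk
          (S'.X.elementsMk n (a.φ.app n σ)) (S'.X.elementsMk m (a.φ.app m (S.X.map θ σ))) θ e) :=
      a.τ.naturality (CategoryOfElements.homMk (S.X.elementsMk n σ)
        (S.X.elementsMk m (S.X.map θ σ)) θ rfl)
    dsimp only [simplicialReplacement]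
    rw [Sigma.ι_desc_assoc, Sigma.ι_desc_assoc, Category.assoc, Sigma.ι_desc,
      summandMap_congr S' θ _ _ _ rfl e]
    simp only [summandMap, Category.assoc, Sigma.ι_desc]
    rw [← Category.assoc, key, Category.assoc]

/-- The simplicial replacement as a functor on the category of natural systems. -/
noncomputable def simplicialReplacementFunctor :
    NatSystem.{w, v, u} A ⥤ SimplicialObject A where
  obj := simplicialReplacement
  map a := simplicialReplacementMap a
  map_id S := by
    ext n
    refine Sigma.hom_ext _ _ fun σ => ?_
    dsimp only [simplicialReplacementMap]
    rw [Sigma.ι_desc]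
    exact (Category.id_comp _).trans (Category.comp_id _).symm
  map_comp {S S' S''} a b := by
    ext n
    refine Sigma.hom_ext _ _ fun σ => ?_
    refine Eq.trans (Sigma.ι_desc _ _) ?_
    have h₁ := Sigma.ι_desc_assoc (fun σ : S.X.obj n => NatSystem.Hom.at a σ ≫
      Sigma.ι (fun ρ : S'.X.obj n => S'.T.obj (S'.X.elementsMk n ρ)) (a.φ.app n σ)) σ
      ((simplicialReplacementMap b).app n)
    refine Eq.trans ?_ h₁.symm
    have h₂ := Sigma.ι_desc (fun σ : S'.X.obj n => NatSystem.Hom.at b σ ≫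
      Sigma.ι (fun ρ : S''.X.obj n => S''.T.obj (S''.X.elementsMk n ρ)) (b.φ.app n σ))
      (a.φ.app n σ)
    refine Eq.trans ?_ (Category.assoc _ _ _).symm
    exact (Category.assoc _ _ _).trans (congrArg (NatSystem.Hom.at a σ ≫ ·) h₂.symm)

/-- The Gabriel-Zisman chain complex `C_*^{GZ}(X, T)`, with `C_n = ⨁_{σ ∈ X_n} T(σ)` and
differential the alternating sum of the maps induced by the cofaces `δⁱ`, as a functor on the
category of contravariant natural systems. -/
noncomputable def chainComplex [Preadditive A] : NatSystem.{w, v, u} A ⥤ ChainComplex A ℕ :=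
  simplicialReplacementFunctor ⋙ AlgebraicTopology.alternatingFaceMapComplex A

/-- Gabriel-Zisman homology `H_n^{GZ}(X, T)`. -/
noncomputable def homology [Abelian A] (n : ℕ) : NatSystem.{w, v, u} A ⥤ A :=
  chainComplex ⋙ HomologicalComplex.homologyFunctor A _ n

end Homology

end GabrielZisman

/-! ### Homological ∂-functors and left satellites -/

section Satellites

/-- A homological `∂`-functor between abelian categories: additive functors `L n`, `n ≥ 0`, and, for
every short exact sequence `0 ⟶ X₁ ⟶ X₂ ⟶ X₃ ⟶ 0`, connecting morphisms `L (n+1) X₃ ⟶ L n X₁` that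
are natural in the short exact sequence and make the long sequence a complex. -/
structure HomologicalDeltaFunctor (B : Type*) [Category B] [Abelian B]
    (C : Type*) [Category C] [Abelian C] where
  /-- the functors -/
  L : ℕ → B ⥤ C
  additive : ∀ n, (L n).Additive
  /-- the connecting morphisms -/
  δ : ∀ (n : ℕ) (S : ShortComplex B), S.ShortExact → ((L (n + 1)).obj S.X₃ ⟶ (L n).obj S.X₁)
  δ_naturality : ∀ (n : ℕ) {S S' : ShortComplex B} (φ : S ⟶ S') (hS : S.ShortExact)
    (hS' : S'.ShortExact),
    (L (n + 1)).map φ.τ₃ ≫ δ n S' hS' = δ n S hS ≫ (L n).map φ.τ₁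
  map_comp_δ : ∀ (n : ℕ) (S : ShortComplex B) (hS : S.ShortExact),
    (L (n + 1)).map S.g ≫ δ n S hS = 0
  δ_comp_map : ∀ (n : ℕ) (S : ShortComplex B) (hS : S.ShortExact),
    δ n S hS ≫ (L n).map S.f = 0

namespace HomologicalDeltaFunctor

variable {B : Type*} [Category B] [Abelian B] {C : Type*} [Category C] [Abelian C]

/-- A morphism of `∂`-functors: natural transformations in every degree that commute with the
connecting morphisms. -/
@[ext]
structure Hom (D D' : HomologicalDeltaFunctor B C) where
  /-- the natural transformation in degree `n` -/
  app : ∀ n, D.L n ⟶ D'.L n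
  comm : ∀ (n : ℕ) (S : ShortComplex B) (hS : S.ShortExact),
    (app (n + 1)).app S.X₃ ≫ D'.δ n S hS = D.δ n S hS ≫ (app n).app S.X₁

/-- A homological `∂`-functor `D` is universal if every natural transformation `D'₀ ⟶ D₀` from the
degree-zero part of a `∂`-functor `D'` extends uniquely to a morphism of `∂`-functors `D' ⟶ D`. -/
def IsUniversal (D : HomologicalDeltaFunctor B C) : Prop :=
  ∀ (D' : HomologicalDeltaFunctor B C) (α : D'.L 0 ⟶ D.L 0),
    ∃! φ : Hom D' D, φ.app 0 = α

/-- Precomposition of a `∂`-functor with an exact functor. -/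
def precomp (D : HomologicalDeltaFunctor B C) {B' : Type*} [Category B'] [Abelian B']
    (G : B' ⥤ B) [G.Additive] [PreservesFiniteLimits G] [PreservesFiniteColimits G] :
    HomologicalDeltaFunctor B' C where
  L n := G ⋙ D.L n
  additive n := by
    have := D.additive n
    infer_instance
  δ n S hS := D.δ n (S.map G) (hS.map_of_exact G)
  δ_naturality n S S' φ hS hS' :=
    D.δ_naturality n (G.mapShortComplex.map φ) (hS.map_of_exact G) (hS'.map_of_exact G)
  map_comp_δ n S hS := D.map_comp_δ n (S.map G) (hS.map_of_exact G)
  δ_comp_map n S hS := D.δ_comp_map n (S.map G) (hS.map_of_exact G)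

/-- Postcomposition of a `∂`-functor with an additive functor. -/
def postcomp (D : HomologicalDeltaFunctor B C) {C' : Type*} [Category C'] [Abelian C']
    (H : C ⥤ C') [H.Additive] : HomologicalDeltaFunctor B C' where
  L n := D.L n ⋙ H
  additive n := by
    have := D.additive n
    infer_instance
  δ n S hS := H.map (D.δ n S hS)
  δ_naturality n S S' φ hS hS' := by
    refine (H.map_comp _ _).symm.trans (Eq.trans ?_ (H.map_comp _ _))
    exact congrArg H.map (D.δ_naturality n φ hS hS')
  map_comp_δ n S hS := by
    refine (H.map_comp _ _).symm.trans (Eq.trans ?_ (H.map_zero _ _))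
    exact congrArg H.map (D.map_comp_δ n S hS)
  δ_comp_map n S hS := by
    refine (H.map_comp _ _).symm.trans (Eq.trans ?_ (H.map_zero _ _))
    exact congrArg H.map (D.δ_comp_map n S hS)

end HomologicalDeltaFunctor

/-- The left satellites of a functor `F`: a universal homological `∂`-functor `(L_q F)_{q ≥ 0}` with
an identification `L_0 F ≅ F`.  They are unique up to unique isomorphism. -/
structure LeftSatellites {B : Type*} [Category B] [Abelian B] {C : Type*} [Category C] [Abelian C]
    (F : B ⥤ C) extends HomologicalDeltaFunctor B C where
  isUniversal : toHomologicalDeltaFunctor.IsUniversal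
  /-- the identification in degree zero -/
  iso₀ : L 0 ≅ F

end Satellites

/-! ### Convergence of first quadrant homology spectral sequences -/

section SpectralSequences

/-- First quadrant homology spectral sequences `E^r_{p,q}`, `r ≥ 2`, `p, q ≥ 0`, with differentials
`d^r : E^r_{p,q} ⟶ E^r_{p-r,q+r-1}`. -/
abbrev E2HomologicalSpectralSequenceNat (A : Type w) [Category.{v} A] [Abelian A] :=
  SpectralSequence A (fun r : ℤ => ComplexShape.spectralSequenceNat (⟨-r, r - 1⟩ : ℤ × ℤ)) 2

/-- For `r ≥ p + q + 2` no differential of the `r`-th page starts or ends at `(p, q)`, so that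
`E^r_{p,q}` is the limit term `E^∞_{p,q}`. -/
theorem spectralSequenceNat_not_rel (p q : ℕ) (r : ℤ) (hr : (p : ℤ) + q + 2 ≤ r) (x : ℕ × ℕ) :
    ¬ (ComplexShape.spectralSequenceNat (⟨-r, r - 1⟩ : ℤ × ℤ)).Rel (p, q) x ∧
      ¬ (ComplexShape.spectralSequenceNat (⟨-r, r - 1⟩ : ℤ × ℤ)).Rel x (p, q) := by
  simp only [ComplexShape.spectralSequenceNat_rel_iff]
  constructor <;> rintro ⟨h₁, h₂⟩ <;> lia

variable {A : Type w} [Category.{v} A] [Abelian A]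

/-- The term `E^2_{p,q}`. -/
def E2HomologicalSpectralSequenceNat.secondPage (E : E2HomologicalSpectralSequenceNat A)
    (p q : ℕ) : A :=
  (E.page 2).X (p, q)

/-- The map of `E^2`-terms induced by a morphism of spectral sequences. -/
def E2HomologicalSpectralSequenceNat.secondPageMap {E E' : E2HomologicalSpectralSequenceNat A}
    (φ : E ⟶ E') (p q : ℕ) : E.secondPage p q ⟶ E'.secondPage p q :=
  (φ.hom 2).f (p, q)

/-- The limit term `E^∞_{p,q} = E^{p+q+2}_{p,q}`. -/
def E2HomologicalSpectralSequenceNat.limitTerm (E : E2HomologicalSpectralSequenceNat A)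
    (p q : ℕ) : A :=
  (E.page ((p : ℤ) + q + 2)).X (p, q)

/-- The map of limit terms induced by a morphism of spectral sequences. -/
def E2HomologicalSpectralSequenceNat.limitTermMap {E E' : E2HomologicalSpectralSequenceNat A}
    (φ : E ⟶ E') (p q : ℕ) : E.limitTerm p q ⟶ E'.limitTerm p q :=
  (φ.hom ((p : ℤ) + q + 2)).f (p, q)

/-- Convergence `E^2_{p,q} ⇒ H_{p+q}`: each `H n` has a filtration
`0 = F_{-1} ≤ F_0 ≤ ... ≤ F_n = H n` with `F_p / F_{p-1} ≅ E^∞_{p,n-p}`.  Here `fil n k` is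
`F_{k-1}`, and the isomorphism is given by a short exact sequence
`0 ⟶ F_{p-1} ⟶ F_p ⟶ E^∞_{p,q} ⟶ 0`, where `p + q = n`. -/
structure Convergence (E : E2HomologicalSpectralSequenceNat A) (H : ℕ → A) where
  /-- the filtration, shifted by one -/
  fil : ∀ n : ℕ, ℕ → Subobject (H n)
  mono : ∀ n, Monotone (fil n)
  fil_zero : ∀ n, fil n 0 = ⊥
  fil_top : ∀ n, fil n (n + 1) = ⊤
  /-- the projection of `F_p` onto the limit term -/
  proj : ∀ p q : ℕ, (fil (p + q) (p + 1) : A) ⟶ E.limitTerm p q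
  ofLE_proj : ∀ p q : ℕ,
    Subobject.ofLE (fil (p + q) p) (fil (p + q) (p + 1)) (mono _ (Nat.le_succ p)) ≫ proj p q = 0
  shortExact : ∀ p q : ℕ, (ShortComplex.mk _ (proj p q) (ofLE_proj p q)).ShortExact

/-- A morphism of spectral sequences and maps of the abutments are compatible if the maps of the
abutments preserve the filtrations and induce on the graded pieces the maps of the limit terms. -/
def Convergence.Compatible {E E' : E2HomologicalSpectralSequenceNat A} {H H' : ℕ → A}
    (c : Convergence E H) (c' : Convergence E' H') (φ : E ⟶ E') (h : ∀ n, H n ⟶ H' n) : Prop :=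
  ∀ p q : ℕ, ∃ a : (c.fil (p + q) (p + 1) : A) ⟶ (c'.fil (p + q) (p + 1) : A),
    a ≫ (c'.fil (p + q) (p + 1)).arrow = (c.fil (p + q) (p + 1)).arrow ≫ h (p + q) ∧
    a ≫ c'.proj p q =
      c.proj p q ≫ E2HomologicalSpectralSequenceNat.limitTermMap φ p q

end SpectralSequences

/-! ### Left Kan extensions between simplex categories -/

namespace GabrielZisman

section Kan

instance hasLeftKanExtension_opSimplicesMap {A : Type w} [Category.{v} A]
    [HasColimitsOfSize.{u, u} A] {X Y : SSet.{u}} (f : X ⟶ Y) (T : OpSimplices X ⥤ A) :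
    (opSimplicesMap f).HasLeftKanExtension T := by
  have : HasColimitsOfSize.{0, u} A := hasColimitsOfSizeOfUnivLE.{u, u, 0, u} A
  infer_instance

/-- A commutative square `f' ∘ g = h ∘ f` of simplicial sets induces a square of simplex categories
that commutes up to the identity maps. -/
def opSimplicesSquareIso {X Y X' Y' : SSet.{u}} (f : X ⟶ Y) (f' : X' ⟶ Y') (g : X ⟶ X')
    (h : Y ⟶ Y') (w : g ≫ f' = f ≫ h) :
    opSimplicesMap g ⋙ opSimplicesMap f' ≅ opSimplicesMap f ⋙ opSimplicesMap h :=
  NatIso.ofComponents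
    (fun x => CategoryOfElements.isoMk _ _ (Iso.refl x.1) (by
      refine (ConcreteCategory.congr_hom (Y'.map_id x.1) _).trans ?_
      exact ConcreteCategory.congr_hom (NatTrans.congr_app w x.1) x.2))
    (fun {x y} k => CategoryOfElements.ext _ _ _
      ((Category.comp_id k.1).trans (Category.id_comp k.1).symm))

variable (A : Type w) [Category.{v} A]

/-- Restriction of natural systems along `(Δ/f)ᵒᵖ`. -/
abbrev res {X Y : SSet.{u}} (f : X ⟶ Y) : (OpSimplices Y ⥤ A) ⥤ (OpSimplices X ⥤ A) :=
  (Functor.whiskeringLeft _ _ A).obj (opSimplicesMap f)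

/-- For a commutative square `f' ∘ g = h ∘ f`, the canonical identification of the two restrictions
along the square. -/
def resSquareIso {X Y X' Y' : SSet.{u}} (f : X ⟶ Y) (f' : X' ⟶ Y') (g : X ⟶ X') (h : Y ⟶ Y')
    (w : g ≫ f' = f ≫ h) : res A f' ⋙ res A g ≅ res A h ⋙ res A f :=
  NatIso.ofComponents
    (fun M => Functor.isoWhiskerRight (opSimplicesSquareIso f f' g h w) M)
    (fun {M N} α => by
      ext x
      exact (α.naturality ((opSimplicesSquareIso f f' g h w).hom.app x)).symm)

variable [HasColimitsOfSize.{u, u} A]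

/-- The left Kan extension functor along `(Δ/f)ᵒᵖ : (Δ/X)ᵒᵖ ⥤ (Δ/Y)ᵒᵖ`. -/
noncomputable abbrev lan {X Y : SSet.{u}} (f : X ⟶ Y) :
    (OpSimplices X ⥤ A) ⥤ (OpSimplices Y ⥤ A) :=
  (opSimplicesMap f).lan

/-- For a commutative square `f' ∘ g = h ∘ f`, the canonical (base change) transformation
`Lan_f (g^* T') ⟶ h^* (Lan_{f'} T')`, i.e. the mate of `g^* f'^* ≅ f^* h^*`. -/
noncomputable def lanBaseChange {X Y X' Y' : SSet.{u}} (f : X ⟶ Y) (f' : X' ⟶ Y') (g : X ⟶ X')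
    (h : Y ⟶ Y') (w : g ≫ f' = f ≫ h) : res A g ⋙ lan A f ⟶ lan A f' ⋙ res A h :=
  ((mateEquiv ((opSimplicesMap f').lanAdjunction A) ((opSimplicesMap f).lanAdjunction A)).symm
    (TwoSquare.mk _ _ _ _ (resSquareIso A f f' g h w).hom)).natTrans

end Kan

section Comparison

variable {A : Type w} [Category.{v} A] [Abelian A] [HasColimitsOfSize.{u, u} A]

/-- For a commutative square `f' ∘ g = h ∘ f` and left satellites of `Lan_f` and `Lan_{f'}`, a
morphism of `∂`-functors `L_q Lan_f (g^* -) ⟶ h^* (L_q Lan_{f'} (-))`, `q ≥ 0`, that in degree zero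
is the canonical transformation `Lan_f (g^* -) ⟶ h^* (Lan_{f'} (-))`. -/
structure SatelliteComparison {X Y X' Y' : SSet.{u}} {f : X ⟶ Y} {f' : X' ⟶ Y'}
    (S : LeftSatellites (lan A f)) (S' : LeftSatellites (lan A f')) (g : X ⟶ X') (h : Y ⟶ Y')
    (w : g ≫ f' = f ≫ h) extends
    HomologicalDeltaFunctor.Hom (S.toHomologicalDeltaFunctor.precomp (res A g))
      (S'.toHomologicalDeltaFunctor.postcomp (res A h)) where
  app_zero : app 0 ≫ Functor.whiskerRight S'.iso₀.hom (res A h) =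
    Functor.whiskerLeft (res A g) S.iso₀.hom ≫ lanBaseChange A f f' g h w

end Comparison

section Leray

/-- The category of maps of simplicial sets with coefficients.  Its objects are maps
`f : X ⟶ Y` of simplicial sets with a contravariant natural system `T` on `X`.  A morphism
`(f : X ⟶ Y, T) ⟶ (f' : X' ⟶ Y', T')` consists of `g : X ⟶ X'`, `h : Y ⟶ Y'` with
`f' ∘ g = h ∘ f` and `τ : T ⟶ T' ∘ (Δ/g)ᵒᵖ`. -/
abbrev MapWithCoeff (A : Type w) [Category.{v} A] :=
  Comma (NatSystem.toSSet.{w, v, u} A) (𝟭 SSet.{u})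

variable {A : Type w} [Category.{v} A]

/-- The map of simplicial sets that underlies an object. -/
abbrev MapWithCoeff.f (c : MapWithCoeff.{w, v, u} A) : c.left.X ⟶ c.right := c.hom

variable [Abelian A] [HasColimitsOfSize.{u, u} A]

/-- The natural system `(Y, L_q ((Δ/f)ᵒᵖ)_* T)`, for a choice `S` of left satellites. -/
def satelliteSystem
    (S : ∀ {X Y : SSet.{u}} (f : X ⟶ Y), LeftSatellites (lan A f))
    (q : ℕ) (c : MapWithCoeff.{w, v, u} A) : NatSystem.{w, v, u} A where
  X := c.right
  T := ((S c.f).L q).obj c.left.T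

/-- The morphism of natural systems `(Y, L_q Lan_f T) ⟶ (Y', L_q Lan_{f'} T')` induced by a morphism
`(g, h, τ)`: it is `h` together with the composite
`L_q Lan_f T ⟶ L_q Lan_f (g^* T') ⟶ h^* (L_q Lan_{f'} T')` of the map induced by `τ` and of the
comparison map of satellites. -/
def satelliteSystemMap
    (S : ∀ {X Y : SSet.{u}} (f : X ⟶ Y), LeftSatellites (lan A f))
    (q : ℕ) {c c' : MapWithCoeff.{w, v, u} A} (m : c ⟶ c')
    (κ : SatelliteComparison (S c.f) (S c'.f) m.left.φ m.right m.w) :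
    satelliteSystem S q c ⟶ satelliteSystem S q c' :=
  NatSystem.Hom.mk m.right (((S c.f).L q).map m.left.τ ≫ (κ.app q).app c'.left.T)

end Leray

end GabrielZisman

/-!
The functor `(Δ/f)ᵒᵖ` is a discrete opfibration: a simplex `x` over `y` and an operator `θ`
determine the simplex `X(θ)(x)` over `Y(θ)(y)`. Hence `(Lan_f T)(y) = ⨁_{f x = y} T(x)`, and this
is exact in `T` because coproducts are exact. So the satellites of `Lan_f` vanish in positive
degrees, while regrouping the summands of `C_n(X, T)` by their images in `Y_n` gives
`C_*(X, T) ≅ C_*(Y, Lan_f T)`. The terms `E^2_{p,q}` with `q > 0` are therefore zero, and the edge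
maps are isomorphisms.
-/

namespace HomologicalDeltaFunctor

variable {B : Type*} [Category B] [Abelian B] {C : Type*} [Category C] [Abelian C]

instance : Category (HomologicalDeltaFunctor B C) where
  Hom := Hom
  id D :=
    { app n := 𝟙 (D.L n)
      comm _ _ _ := by simp }
  comp a b :=
    { app n := a.app n ≫ b.app n
      comm n S hS := by
        rw [NatTrans.comp_app, NatTrans.comp_app, Category.assoc, b.comm,
          reassoc_of% (a.comm n S hS)] }
  id_comp a := Hom.ext (funext fun n => Category.id_comp (a.app n))
  comp_id a := Hom.ext (funext fun n => Category.comp_id (a.app n))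
  assoc a b c := Hom.ext (funext fun n => Category.assoc (a.app n) (b.app n) (c.app n))

variable (B C) in
/-- The functor that sends a `∂`-functor to its part of degree `n`. -/
def degree (n : ℕ) : HomologicalDeltaFunctor B C ⥤ B ⥤ C where
  obj D := D.L n
  map φ := φ.app n

namespace IsUniversal

variable {D D' : HomologicalDeltaFunctor B C}

/-- The extension of a natural transformation in degree zero to a morphism of `∂`-functors with
values in a universal one. -/
noncomputable def lift (hD : D.IsUniversal) (α : D'.L 0 ⟶ D.L 0) : D' ⟶ D :=
  (hD D' α).choose

@[simp]
theorem lift_app_zero (hD : D.IsUniversal) (α : D'.L 0 ⟶ D.L 0) : (hD.lift α).app 0 = α :=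
  (hD D' α).choose_spec.1

theorem hom_ext (hD : D.IsUniversal) {φ ψ : D' ⟶ D} (h : φ.app 0 = ψ.app 0) : φ = ψ :=
  (hD D' (ψ.app 0)).unique h rfl

/-- Universal `∂`-functors with isomorphic parts of degree zero are isomorphic. -/
noncomputable def isoOfIso (hD : D.IsUniversal) (hD' : D'.IsUniversal) (e : D.L 0 ≅ D'.L 0) :
    D ≅ D' where
  hom := hD'.lift e.hom
  inv := hD.lift e.inv
  hom_inv_id := hD.hom_ext <| by
    change (hD'.lift e.hom).app 0 ≫ (hD.lift e.inv).app 0 = 𝟙 _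
    simp
  inv_hom_id := hD'.hom_ext <| by
    change (hD.lift e.inv).app 0 ≫ (hD'.lift e.hom).app 0 = 𝟙 _
    simp

end IsUniversal

theorem isUniversal_of_isZero (D : HomologicalDeltaFunctor B C) [(D.L 0).PreservesMonomorphisms]
    (hD : ∀ n, IsZero (D.L (n + 1))) : D.IsUniversal := by
  intro D' α
  have comm_zero (S : ShortComplex B) (hS : S.ShortExact) : D'.δ 0 S hS ≫ α.app S.X₁ = 0 := by
    have := hS.mono_f
    rw [← cancel_mono ((D.L 0).map S.f), Category.assoc, ← α.naturality,
      reassoc_of% (D'.δ_comp_map 0 S hS), zero_comp, zero_comp]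
  let φ : Hom D' D :=
    { app
        | 0 => α
        | n + 1 => (hD n).from_ _
      comm
        | 0, S, hS => by
          rw [comm_zero, ((hD 0).obj S.X₃).eq_zero_of_src (D.δ 0 S hS), comp_zero]
        | n + 1, S, hS => ((hD n).obj S.X₁).eq_of_tgt _ _ }
  refine ⟨φ, rfl, fun ψ hψ => Hom.ext (funext ?_)⟩
  rintro (_ | n)
  · exact hψ
  · exact (hD n).eq_of_tgt _ _

open scoped ZeroObject

/-- An additive functor, viewed as a `∂`-functor that vanishes in positive degrees. -/
noncomputable def concentrated (F : B ⥤ C) [F.Additive] : HomologicalDeltaFunctor B C where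
  L
    | 0 => F
    | _ + 1 => 0
  additive
    | 0 => inferInstanceAs F.Additive
    | _ + 1 => inferInstanceAs (0 : B ⥤ C).Additive
  δ _ _ _ := 0
  δ_naturality _ _ _ _ _ _ := by simp
  map_comp_δ _ _ _ := comp_zero
  δ_comp_map _ _ _ := zero_comp

end HomologicalDeltaFunctor

namespace LeftSatellites

variable {B : Type*} [Category B] [Abelian B] {C : Type*} [Category C] [Abelian C] {F : B ⥤ C}

/-- Left satellites of the same functor are isomorphic. -/
noncomputable def uniqueUpToIso (S S' : LeftSatellites F) :
    S.toHomologicalDeltaFunctor ≅ S'.toHomologicalDeltaFunctor :=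
  S.isUniversal.isoOfIso S'.isUniversal (S.iso₀ ≪≫ S'.iso₀.symm)

variable [F.PreservesMonomorphisms]

instance (S : LeftSatellites F) : (S.L 0).PreservesMonomorphisms :=
  Functor.PreservesMonomorphisms.of_iso S.iso₀.symm

variable [F.Additive]

variable (F) in
/-- The left satellites of a functor that preserves monomorphisms: they vanish in positive
degrees. -/
noncomputable def ofPreservesMonomorphisms : LeftSatellites F where
  toHomologicalDeltaFunctor := .concentrated F
  isUniversal := by
    have : ((HomologicalDeltaFunctor.concentrated F).L 0).PreservesMonomorphisms :=
      inferInstanceAs F.PreservesMonomorphisms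
    exact HomologicalDeltaFunctor.isUniversal_of_isZero _ fun _ => isZero_zero (B ⥤ C)
  iso₀ := Iso.refl F

theorem isZero_L_succ (S : LeftSatellites F) (n : ℕ) : IsZero (S.L (n + 1)) :=
  (isZero_zero (B ⥤ C)).of_iso <|
    (HomologicalDeltaFunctor.degree B C (n + 1)).mapIso
      (S.uniqueUpToIso (.ofPreservesMonomorphisms F))

end LeftSatellites

namespace GabrielZisman

section Fibre

variable {C : Type*} [Category C] {F G : C ⥤ Type u} {f : F ⟶ G} {y : G.Elements}

variable (f y) in
/-- The fibre of a map `f : F ⟶ G` of functors over an element `y` of `G`. -/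
abbrev Fibre : Type u := {x : F.obj y.1 // f.app y.1 x = y.2}

namespace Fibre

/-- The element of `F` given by a point of the fibre. -/
abbrev element (x : Fibre f y) : F.Elements := F.elementsMk y.1 x.1

/-- The image of a point of the fibre over `y` is `y`, as a morphism over the identity of `C`. -/
def toBase (x : Fibre f y) : (CategoryOfElements.map f).obj x.element ⟶ y :=
  CategoryOfElements.homMk _ _ (𝟙 y.1) ((ConcreteCategory.congr_hom (G.map_id y.1) _).trans x.2)

variable (f y) in
/-- The inclusion of the fibre of `f` over `y` into the comma category of `y`. -/
abbrev inclusion : Discrete (Fibre f y) ⥤ CostructuredArrow (CategoryOfElements.map f) y :=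
  Discrete.functor fun x => CostructuredArrow.mk x.toBase

/-- The endpoint of the lift of `f a ⟶ y` to a morphism out of `a`. -/
def lift (a : CostructuredArrow (CategoryOfElements.map f) y) : Fibre f y :=
  ⟨F.map a.hom.1 a.left.2, (NatTrans.naturality_apply f a.hom.1 a.left.2).trans a.hom.2⟩

/-- The lift of `f a ⟶ y` to a morphism out of `a`, which is unique since `f` is a discrete
opfibration on categories of elements. -/
def toLift (a : CostructuredArrow (CategoryOfElements.map f) y) :
    a ⟶ (inclusion f y).obj ⟨lift a⟩ :=
  CostructuredArrow.homMk (CategoryOfElements.homMk _ _ a.hom.1 rfl)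
    (CategoryOfElements.ext _ _ _ (Category.comp_id a.hom.1))

theorem left_val_of_hom {a : CostructuredArrow (CategoryOfElements.map f) y}
    {x : Discrete (Fibre f y)} (k : a ⟶ (inclusion f y).obj x) : k.left.1 = a.hom.1 :=
  (Category.comp_id k.left.1).symm.trans (congrArg Subtype.val (CostructuredArrow.w k))

theorem lift_eq_of_hom {a : CostructuredArrow (CategoryOfElements.map f) y}
    {x : Discrete (Fibre f y)} (k : a ⟶ (inclusion f y).obj x) : lift a = x.as :=
  Subtype.ext <| by
    change F.map a.hom.1 a.left.2 = x.as.1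
    rw [← left_val_of_hom k]
    exact k.left.2

instance (a : CostructuredArrow (CategoryOfElements.map f) y) (x : Discrete (Fibre f y)) :
    Subsingleton (a ⟶ (inclusion f y).obj x) where
  allEq k k' := by
    ext
    exact (left_val_of_hom k).trans (left_val_of_hom k').symm

/-- Every morphism from `a` to a point of the fibre factors uniquely through the lift. -/
def isInitialToLift (a : CostructuredArrow (CategoryOfElements.map f) y) :
    IsInitial (StructuredArrow.mk (toLift a)) :=
  IsInitial.ofUniqueHom
    (fun b => StructuredArrow.homMk (Discrete.eqToHom (lift_eq_of_hom b.hom))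
      (Subsingleton.elim _ _))
    (fun _ _ => StructuredArrow.hom_ext _ _ (Subsingleton.elim _ _))

instance : (inclusion f y).Final where
  out a := isConnected_of_isInitial _ (isInitialToLift a)

end Fibre

variable {A : Type w} [Category.{v} A]

instance [HasCoproducts.{u} A] (T : F.Elements ⥤ A) :
    (CategoryOfElements.map f).HasPointwiseLeftKanExtension T := fun y =>
  have : HasColimit (Fibre.inclusion f y ⋙ CostructuredArrow.proj _ y ⋙ T) := inferInstance
  Functor.Final.hasColimit_of_comp (Fibre.inclusion f y)

variable {T : F.Elements ⥤ A} {T' : G.Elements ⥤ A} (τ : T ⟶ CategoryOfElements.map f ⋙ T')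

/-- The cofan with point `T' y` and summands `T x` for the points `x` of the fibre over `y`. -/
def fibreCofan (y : G.Elements) : Cofan fun x : Fibre f y => T.obj x.element :=
  Cofan.mk (T'.obj y) fun x => τ.app x.element ≫ T'.map x.toBase

theorem fibreCofan_inj_self (x : F.Elements) :
    (fibreCofan τ ((CategoryOfElements.map f).obj x)).inj ⟨x.2, rfl⟩ = τ.app x :=
  (congrArg (τ.app x ≫ ·) (T'.map_id _)).trans (Category.comp_id _)

/-- Left Kan extension along a discrete opfibration is given by the coproducts over the fibres. -/
noncomputable def isColimitFibreCofan [HasCoproducts.{u} A] [T'.IsLeftKanExtension τ]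
    (y : G.Elements) : IsColimit (fibreCofan τ y) :=
  have hc : IsColimit ((Functor.LeftExtension.mk T' τ).coconeAt y) :=
    Functor.isPointwiseLeftKanExtensionOfIsLeftKanExtension T' τ y
  ((IsColimit.precomposeInvEquiv Discrete.natIsoFunctor _).symm
    ((Functor.Final.isColimitWhiskerEquiv (Fibre.inclusion f y) _).symm hc)).ofIsoColimit
      (Cocone.ext (Iso.refl _) fun _ => (Category.comp_id _).trans (Category.id_comp _))

theorem mono_of_isLeftKanExtension [HasPullbacks A] [HasCoproducts.{u} A] [AB4OfSize.{u} A]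
    {T₁ T₂ : F.Elements ⥤ A} {T₁' T₂' : G.Elements ⥤ A}
    (τ₁ : T₁ ⟶ CategoryOfElements.map f ⋙ T₁') (τ₂ : T₂ ⟶ CategoryOfElements.map f ⋙ T₂')
    [T₁'.IsLeftKanExtension τ₁] [T₂'.IsLeftKanExtension τ₂] (η : T₁ ⟶ T₂) [Mono η]
    (η' : T₁' ⟶ T₂') (hη : τ₁ ≫ Functor.whiskerLeft _ η' = η ≫ τ₂) : Mono η' := by
  have (y : G.Elements) : Mono (η'.app y) := by
    let ηy : (Discrete.functor fun x : Fibre f y => T₁.obj x.element) ⟶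
        Discrete.functor fun x : Fibre f y => T₂.obj x.element :=
      Discrete.natTrans fun x => η.app x.as.element
    have (x : Discrete (Fibre f y)) : Mono (ηy.app x) :=
      (NatTrans.mono_iff_mono_app η).1 inferInstance x.as.element
    have : Mono ηy := NatTrans.mono_of_mono_app ηy
    refine colim.map_mono' ηy (isColimitFibreCofan τ₁ y) (isColimitFibreCofan τ₂ y) _ ?_
    rintro ⟨x⟩
    have hx : τ₁.app x.element ≫ η'.app _ = η.app x.element ≫ τ₂.app x.element :=
      NatTrans.congr_app hη x.element
    change (τ₁.app x.element ≫ T₁'.map x.toBase) ≫ η'.app y =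
      η.app x.element ≫ τ₂.app x.element ≫ T₂'.map x.toBase
    rw [Category.assoc, η'.naturality, reassoc_of% hx]
  exact NatTrans.mono_of_mono_app η'

instance [HasPullbacks A] [HasCoproducts.{u} A] [AB4OfSize.{u} A] :
    ((CategoryOfElements.map f).lan : (F.Elements ⥤ A) ⥤ _).PreservesMonomorphisms where
  preserves {T₁ T₂} η _ :=
    mono_of_isLeftKanExtension ((CategoryOfElements.map f).lanUnit.app T₁)
      ((CategoryOfElements.map f).lanUnit.app T₂) η _
      ((CategoryOfElements.map f).lanUnit.naturality η).symm

end Fibre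

section Lan

variable {A : Type w} [Category.{v} A] [Abelian A] [HasColimitsOfSize.{u, u} A] {X Y : SSet.{u}}
  (f : X ⟶ Y)

instance : (lan A f).Additive :=
  ((opSimplicesMap f).lanAdjunction A).left_adjoint_additive

end Lan

section Homology

/-- A coproduct over the total space of `φ`, computed as a coproduct of coproducts over the
fibres. -/
def isColimitOfFibres {A : Type*} [Category A] {I J : Type*} (φ : I → J) {X : I → A}
    {c : ∀ j, Cofan fun i : {i // φ i = j} => X i} (hc : ∀ j, IsColimit (c j))
    {d : Cofan fun j => (c j).pt} (hd : IsColimit d) :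
    IsColimit (Cofan.mk (f := X) d.pt fun i => (c (φ i)).inj ⟨i, rfl⟩ ≫ d.inj (φ i)) :=
  Cofan.isColimitEquivOfEquiv (Equiv.sigmaFiberEquiv φ).symm _
    (Cofan.isColimitTrans d hd (fun j => (c j).inj) hc)

variable {A : Type w} [Category.{v} A]

theorem isIso_simplicialReplacementMap [HasCoproducts.{u} A] {S S' : NatSystem.{w, v, u} A}
    (a : S ⟶ S') [S'.T.IsLeftKanExtension a.τ] : IsIso (simplicialReplacementMap a) := by
  have (n : SimplexCategoryᵒᵖ) : IsIso ((simplicialReplacementMap a).app n) := by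
    let ι (ρ : S'.X.obj n) := Sigma.ι (fun ρ => S'.T.obj (S'.X.elementsMk n ρ)) ρ
    refine (Cofan.nonempty_isColimit_iff_isIso_sigmaDesc
      (Cofan.mk _ fun σ => NatSystem.Hom.at a σ ≫ ι (a.φ.app n σ))).1 ⟨?_⟩
    refine (isColimitOfFibres (a.φ.app n)
      (fun y => isColimitFibreCofan a.τ (S'.X.elementsMk n y))
      (coproductIsCoproduct _)).ofIsoColimit (Cofan.ext (Iso.refl _) fun σ => ?_)
    exact (Category.comp_id _).trans
      (congrArg (· ≫ ι (a.φ.app n σ)) (fibreCofan_inj_self a.τ (S.X.elementsMk n σ)))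
  exact NatIso.isIso_of_isIso_app _

variable [Abelian A] [HasCoproducts.{u} A]

theorem isIso_homology_map {S S' : NatSystem.{w, v, u} A} (a : S ⟶ S')
    [S'.T.IsLeftKanExtension a.τ] (p : ℕ) : IsIso ((homology p).map a) := by
  have : IsIso (simplicialReplacementFunctor.map a) := isIso_simplicialReplacementMap a
  exact inferInstanceAs (IsIso ((AlgebraicTopology.alternatingFaceMapComplex A ⋙
    HomologicalComplex.homologyFunctor A _ p).map (simplicialReplacementFunctor.map a)))

theorem isZero_homology {S : NatSystem.{w, v, u} A} (hS : IsZero S.T) (p : ℕ) :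
    IsZero ((homology p).obj S) := by
  have : IsZero ((chainComplex.obj S).X p) :=
    (IsZero.iff_id_eq_zero _).2 (Sigma.hom_ext _ _ fun σ => (hS.obj _).eq_of_src _ _)
  exact (ShortComplex.exact_iff_isZero_homology _).1 (ShortComplex.exact_of_isZero_X₂ _ this)

end Homology

end GabrielZisman

section DegenerateSpectralSequence

variable {κ : Type*}

/-- The complex with a given underlying graded object and zero differentials. -/
def zeroDifferentialComplex (A : Type*) [Category A] [HasZeroMorphisms A] (c : ComplexShape κ) :
    GradedObject κ A ⥤ HomologicalComplex A c where
  obj X := { X := X, d _ _ := 0 }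
  map φ := { f := φ }

variable (A : Type*) [Category A] [Abelian A]

/-- The homology of a complex with zero differentials is the underlying graded object. -/
noncomputable def zeroDifferentialComplexHomologyIso (c : ComplexShape κ) (i : κ) :
    zeroDifferentialComplex A c ⋙ HomologicalComplex.homologyFunctor A c i ≅
      zeroDifferentialComplex A c ⋙ HomologicalComplex.eval A c i :=
  NatIso.ofComponents
    (fun X => (ShortComplex.LeftHomologyData.ofZeros
      (((zeroDifferentialComplex A c).obj X).sc i) rfl rfl).homologyIso)
    (fun φ => (ShortComplex.LeftHomologyMapData.ofZeros
      ((HomologicalComplex.shortComplexFunctor A c i).map ((zeroDifferentialComplex A c).map φ))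
      rfl rfl rfl rfl).homologyMap_comm)

/-- The spectral sequence all of whose pages are a given graded object, with zero differentials. -/
noncomputable def degenerateSpectralSequence (c : ℤ → ComplexShape κ) (r₀ : ℤ) :
    GradedObject κ A ⥤ SpectralSequence A c r₀ where
  obj X :=
    { page r _ := (zeroDifferentialComplex A (c r)).obj X
      iso r _ pq _ _ := (zeroDifferentialComplexHomologyIso A (c r) pq).app X }
  map φ :=
    { hom r _ := (zeroDifferentialComplex A (c r)).map φ
      comm r _ pq _ _ := (zeroDifferentialComplexHomologyIso A (c r) pq).hom.naturality φ }

end DegenerateSpectralSequence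

open scoped ZeroObject

namespace E2HomologicalSpectralSequenceNat

variable (A : Type w) [Category.{v} A] [Abelian A]

/-- The degenerate spectral sequence with `E^r_{p,0} = H p` and `E^r_{p,q} = 0` for `q > 0`. -/
noncomputable def bottomRow : GradedObject ℕ A ⥤ E2HomologicalSpectralSequenceNat A :=
  Functor.pi' (fun
    | (p, 0) => GradedObject.eval p
    | (_, _ + 1) => 0) ⋙ degenerateSpectralSequence A _ 2

variable {A}

theorem isZero_secondPage_bottomRow (H : GradedObject ℕ A) (p q : ℕ) :
    IsZero (((bottomRow A).obj H).secondPage p (q + 1)) :=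
  (isZero_zero (GradedObject ℕ A ⥤ A)).obj H

/-- The term `E^2_{p,0}` of the spectral sequence with bottom row `H`. -/
noncomputable def secondPageBottomRowIso (H : GradedObject ℕ A) (p : ℕ) :
    ((bottomRow A).obj H).secondPage p 0 ≅ H p :=
  Iso.refl (H p)

theorem secondPageBottomRowIso_naturality {H H' : GradedObject ℕ A} (h : H ⟶ H') (p : ℕ) :
    secondPageMap ((bottomRow A).map h) p 0 ≫ (secondPageBottomRowIso H' p).hom =
      (secondPageBottomRowIso H p).hom ≫ h p :=
  (Category.comp_id _).trans (Category.id_comp _).symm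

theorem isZero_limitTerm_bottomRow (H : GradedObject ℕ A) (p q : ℕ) :
    IsZero (((bottomRow A).obj H).limitTerm p (q + 1)) :=
  (isZero_zero (GradedObject ℕ A ⥤ A)).obj H

/-- The term `E^∞_{n,0}` of the spectral sequence with bottom row `H`. -/
noncomputable def limitTermBottomRowIso (H : GradedObject ℕ A) (n : ℕ) :
    ((bottomRow A).obj H).limitTerm n 0 ≅ H n :=
  Iso.refl (H n)

theorem limitTermBottomRowIso_naturality {H H' : GradedObject ℕ A} (h : H ⟶ H') (n : ℕ) :
    limitTermMap ((bottomRow A).map h) n 0 ≫ (limitTermBottomRowIso H' n).hom =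
      (limitTermBottomRowIso H n).hom ≫ h n :=
  (Category.comp_id _).trans (Category.id_comp _).symm

end E2HomologicalSpectralSequenceNat

section Convergence

variable {A : Type w} [Category.{v} A] [Abelian A]

theorem isZero_coe_of_eq_bot {Z : A} {P : Subobject Z} (h : P = ⊥) : IsZero (P : A) := by
  subst h
  exact (isZero_zero A).of_iso Subobject.botCoeIsoZero

/-- The filtration `0 = F_{-1} = ... = F_{n-1} ≤ F_n = H n`, with the shift by one of
`Convergence.fil`. -/
noncomputable def topStepFiltration (H : ℕ → A) (n k : ℕ) : Subobject (H n) :=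
  if k ≤ n then ⊥ else ⊤

theorem topStepFiltration_of_le (H : ℕ → A) {n k : ℕ} (h : k ≤ n) : topStepFiltration H n k = ⊥ :=
  if_pos h

theorem topStepFiltration_of_lt (H : ℕ → A) {n k : ℕ} (h : n < k) : topStepFiltration H n k = ⊤ :=
  if_neg h.not_ge

theorem monotone_topStepFiltration (H : ℕ → A) (n : ℕ) : Monotone (topStepFiltration H n) := by
  intro i j hij
  rcases le_or_gt i n with hi | hi
  · exact (topStepFiltration_of_le H hi).trans_le bot_le
  · exact le_top.trans_eq (topStepFiltration_of_lt H (hi.trans_le hij)).symm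

variable {E E' : E2HomologicalSpectralSequenceNat A} {H H' : ℕ → A}

/-- The projection of the steps of `topStepFiltration` onto the limit terms of a spectral sequence
with `E^∞_{n,0} ≅ H n`. -/
noncomputable def topStepFiltrationProj (e : ∀ n, E.limitTerm n 0 ≅ H n) (p : ℕ) :
    ∀ q : ℕ, (topStepFiltration H (p + q) (p + 1) : A) ⟶ E.limitTerm p q
  | 0 => (topStepFiltration H p (p + 1)).arrow ≫ (e p).inv
  | _ + 1 => 0

theorem isIso_topStepFiltrationProj (e : ∀ n, E.limitTerm n 0 ≅ H n)
    (hE : ∀ p q, IsZero (E.limitTerm p (q + 1))) (p : ℕ) :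
    ∀ q : ℕ, IsIso (topStepFiltrationProj e p q)
  | 0 =>
    have := (Subobject.isIso_arrow_iff_eq_top _).2 (topStepFiltration_of_lt H p.lt_succ_self)
    inferInstanceAs (IsIso ((topStepFiltration H p (p + 1)).arrow ≫ (e p).inv))
  | q + 1 => (isZero_coe_of_eq_bot (topStepFiltration_of_le H (by lia))).isIso (hE p q) _

/-- A spectral sequence with `E^∞_{p,q} = 0` for `q > 0` converges to its row `q = 0`. -/
noncomputable def Convergence.ofBottomRow (e : ∀ n, E.limitTerm n 0 ≅ H n)
    (hE : ∀ p q, IsZero (E.limitTerm p (q + 1))) : Convergence E H where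
  fil := topStepFiltration H
  mono := monotone_topStepFiltration H
  fil_zero n := topStepFiltration_of_le H n.zero_le
  fil_top n := topStepFiltration_of_lt H n.lt_succ_self
  proj := topStepFiltrationProj e
  ofLE_proj p q :=
    (isZero_coe_of_eq_bot (topStepFiltration_of_le H (p.le_add_right q))).eq_of_src _ _
  shortExact p q :=
    have hF : IsZero (topStepFiltration H (p + q) p : A) :=
      isZero_coe_of_eq_bot (topStepFiltration_of_le H (p.le_add_right q))
    have := isIso_topStepFiltrationProj e hE p q
    { exact := (ShortComplex.exact_iff_mono _ (hF.eq_of_src _ _)).2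
        (inferInstanceAs (Mono (topStepFiltrationProj e p q)))
      mono_f := ⟨fun _ _ _ => hF.eq_of_tgt _ _⟩
      epi_g := inferInstanceAs (Epi (topStepFiltrationProj e p q)) }

theorem Convergence.ofBottomRow_compatible (e : ∀ n, E.limitTerm n 0 ≅ H n)
    (hE : ∀ p q, IsZero (E.limitTerm p (q + 1))) (e' : ∀ n, E'.limitTerm n 0 ≅ H' n)
    (hE' : ∀ p q, IsZero (E'.limitTerm p (q + 1))) (φ : E ⟶ E') (h : ∀ n, H n ⟶ H' n)
    (comm : ∀ n, E2HomologicalSpectralSequenceNat.limitTermMap φ n 0 ≫ (e' n).hom =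
      (e n).hom ≫ h n) :
    (ofBottomRow e hE).Compatible (ofBottomRow e' hE') φ h := by
  rintro p (_ | q)
  · have := (Subobject.isIso_arrow_iff_eq_top _).2 (topStepFiltration_of_lt H' p.lt_succ_self)
    let a := (topStepFiltration H p (p + 1)).arrow ≫ h p ≫
      inv (topStepFiltration H' p (p + 1)).arrow
    have ha : a ≫ (topStepFiltration H' p (p + 1)).arrow =
        (topStepFiltration H p (p + 1)).arrow ≫ h p := by simp [a]
    refine ⟨a, ha, ?_⟩
    change a ≫ (topStepFiltration H' p (p + 1)).arrow ≫ (e' p).inv =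
      ((topStepFiltration H p (p + 1)).arrow ≫ (e p).inv) ≫ _
    rw [reassoc_of% ha, Category.assoc, (CommSq.mk (comm p)).vert_inv.w]
  · exact ⟨0, (isZero_coe_of_eq_bot (topStepFiltration_of_le H (by lia))).eq_of_src _ _,
      (hE' p q).eq_of_tgt _ _⟩

end Convergence

namespace GabrielZisman

section SatelliteComparison

variable {A : Type w} [Category.{v} A] [Abelian A] [HasColimitsOfSize.{u, u} A]
  [AB4OfSize.{u} A] {X Y X' Y' : SSet.{u}} {f : X ⟶ Y} {f' : X' ⟶ Y'}
  {S : LeftSatellites (lan A f)} {S' : LeftSatellites (lan A f')} {g : X ⟶ X'} {h : Y ⟶ Y'}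
  {w : g ≫ f' = f ≫ h}

theorem isUniversal_postcomp_res (S : LeftSatellites (lan A f)) {Z : SSet.{u}} (h : Z ⟶ Y) :
    (S.toHomologicalDeltaFunctor.postcomp (res A h)).IsUniversal := by
  have : ((S.toHomologicalDeltaFunctor.postcomp (res A h)).L 0).PreservesMonomorphisms :=
    inferInstanceAs (S.L 0 ⋙ res A h).PreservesMonomorphisms
  refine HomologicalDeltaFunctor.isUniversal_of_isZero _ fun n => ?_
  exact Functor.isZero _ fun T => (res A h).map_isZero ((S.isZero_L_succ n).obj T)

instance : Nonempty (SatelliteComparison S S' g h w) :=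
  let α : res A g ⋙ S.L 0 ⟶ S'.L 0 ⋙ res A h :=
    (Functor.whiskerLeft (res A g) S.iso₀.hom ≫ lanBaseChange A f f' g h w) ≫
      (Functor.isoWhiskerRight S'.iso₀ (res A h)).inv
  have hS' := isUniversal_postcomp_res S' h
  ⟨{ toHom := hS'.lift (D' := S.toHomologicalDeltaFunctor.precomp (res A g)) α
     app_zero := (Iso.eq_comp_inv (Functor.isoWhiskerRight S'.iso₀ (res A h))).1
       (hS'.lift_app_zero _) }⟩

instance : Subsingleton (SatelliteComparison S S' g h w) where
  allEq := by
    rintro ⟨κ, hκ⟩ ⟨κ', hκ'⟩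
    obtain rfl : κ = κ' := (isUniversal_postcomp_res S' h).hom_ext
      ((cancel_mono (Functor.isoWhiskerRight S'.iso₀ (res A h)).hom).1 (hκ.trans hκ'.symm))
    rfl

end SatelliteComparison

theorem lanUnit_lanBaseChange {A : Type w} [Category.{v} A] [HasColimitsOfSize.{u, u} A]
    {X Y X' Y' : SSet.{u}} (f : X ⟶ Y) (f' : X' ⟶ Y') (g : X ⟶ X') (h : Y ⟶ Y')
    (w : g ≫ f' = f ≫ h) (T : OpSimplices X' ⥤ A) :
    (opSimplicesMap f).lanUnit.app ((res A g).obj T) ≫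
        (res A f).map ((lanBaseChange A f f' g h w).app T) =
      (res A g).map ((opSimplicesMap f').lanUnit.app T) ≫
        (resSquareIso A f f' g h w).hom.app ((lan A f').obj T) := by
  have mate := (unit_mateEquiv_symm ((opSimplicesMap f').lanAdjunction A)
    ((opSimplicesMap f).lanAdjunction A)
    (TwoSquare.mk _ _ _ _ (resSquareIso A f f' g h w).hom) T).symm
  rwa [Functor.lanAdjunction_unit, Functor.lanAdjunction_unit] at mate

section SatelliteUnit

variable {A : Type w} [Category.{v} A] [Abelian A] [HasColimitsOfSize.{u, u} A]
  {X Y X' Y' : SSet.{u}} {f : X ⟶ Y} {f' : X' ⟶ Y'}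
  {S : LeftSatellites (lan A f)} {S' : LeftSatellites (lan A f')} {g : X ⟶ X'} {h : Y ⟶ Y'}
  {w : g ≫ f' = f ≫ h}

/-- The unit of the adjunction between `L_0 Lan_f ≅ Lan_f` and the restriction along `f`. -/
noncomputable def satelliteUnit (S : LeftSatellites (lan A f)) : 𝟭 _ ⟶ S.L 0 ⋙ res A f :=
  (opSimplicesMap f).lanUnit ≫ Functor.whiskerRight S.iso₀.inv (res A f)

theorem isLeftKanExtension_satelliteUnit (S : LeftSatellites (lan A f))
    (T : OpSimplices X ⥤ A) : ((S.L 0).obj T).IsLeftKanExtension ((satelliteUnit S).app T) :=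
  (Functor.isLeftKanExtension_iff_of_iso (S.iso₀.symm.app T)
    ((opSimplicesMap f).lanUnit.app T) _ rfl).1 inferInstance

/-- The part of degree zero of a comparison of satellites. -/
def SatelliteComparison.zero (κ : SatelliteComparison S S' g h w) :
    res A g ⋙ S.L 0 ⟶ S'.L 0 ⋙ res A h :=
  κ.app 0

theorem SatelliteComparison.inv_app_comp_zero_app (κ : SatelliteComparison S S' g h w)
    (T : OpSimplices X' ⥤ A) :
    S.iso₀.inv.app ((res A g).obj T) ≫ κ.zero.app T =
      (lanBaseChange A f f' g h w).app T ≫ (res A h).map (S'.iso₀.inv.app T) :=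
  (Iso.inv_comp_eq (S.iso₀.app ((res A g).obj T))).2 <|
    ((Iso.eq_comp_inv ((res A h).mapIso (S'.iso₀.app T))).2
      (NatTrans.congr_app κ.app_zero T)).trans (Category.assoc _ _ _)

theorem satelliteUnit_comp_zero_app (κ : SatelliteComparison S S' g h w)
    (T : OpSimplices X' ⥤ A) :
    (satelliteUnit S).app ((res A g).obj T) ≫ (res A f).map (κ.zero.app T) =
      (res A g).map ((satelliteUnit S').app T) ≫
        (resSquareIso A f f' g h w).hom.app ((S'.L 0).obj T) := by
  have r_naturality :
      (res A g).map ((res A f').map (S'.iso₀.inv.app T)) ≫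
          (resSquareIso A f f' g h w).hom.app ((S'.L 0).obj T) =
        (resSquareIso A f f' g h w).hom.app ((lan A f').obj T) ≫
          (res A f).map ((res A h).map (S'.iso₀.inv.app T)) :=
    (resSquareIso A f f' g h w).hom.naturality (S'.iso₀.inv.app T)
  change (_ ≫ (res A f).map (S.iso₀.inv.app _)) ≫ _ =
    (res A g).map (_ ≫ (res A f').map (S'.iso₀.inv.app _)) ≫ _
  rw [Category.assoc, ← Functor.map_comp, κ.inv_app_comp_zero_app, Functor.map_comp,
    reassoc_of% lanUnit_lanBaseChange, Functor.map_comp, Category.assoc, r_naturality]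

end SatelliteUnit

theorem NatSystem.hom_ext_of_natTrans {A : Type w} [Category.{v} A] {S S' : NatSystem.{w, v, u} A}
    {a b : S ⟶ S'} (e : opSimplicesMap a.φ ⟶ opSimplicesMap b.φ) (he : ∀ x, (e.app x).1 = 𝟙 x.1)
    (hτ : a.τ ≫ Functor.whiskerRight e S'.T = b.τ) : a = b := by
  obtain ⟨φ, τ⟩ := a
  obtain ⟨φ', τ'⟩ := b
  obtain rfl : φ = φ' := by
    ext n x
    have := (e.app (S.X.elementsMk n x)).2
    rw [he] at this
    exact (ConcreteCategory.congr_hom (S'.X.map_id n) _).symm.trans this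
  obtain rfl : e = 𝟙 (opSimplicesMap φ) := by
    ext x
    exact he x
  refine Hom.ext rfl (heq_of_eq (Eq.trans ?_ hτ))
  exact ((congrArg (τ ≫ ·) (Functor.whiskerRight_id' S'.T)).trans (Category.comp_id τ)).symm

section Leray

open E2HomologicalSpectralSequenceNat

variable (A : Type w) [Category.{v} A] [Abelian A] [HasColimitsOfSize.{u, u} A]

/-- The Gabriel–Zisman homology in all degrees, as a graded object. -/
noncomputable def gradedHomology : NatSystem.{w, v, u} A ⥤ GradedObject ℕ A :=
  Functor.pi' homology

/-- The Leray spectral sequence of `(f : X ⟶ Y, T)`: the homology of `(X, T)` in the row `q = 0`. -/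
noncomputable def lerayFunctor : MapWithCoeff.{w, v, u} A ⥤ E2HomologicalSpectralSequenceNat A :=
  Comma.fst _ _ ⋙ gradedHomology A ⋙ bottomRow A

/-- The Leray spectral sequence of `(f : X ⟶ Y, T)` converges to the homology of `(X, T)`. -/
noncomputable def lerayConvergence (c : MapWithCoeff.{w, v, u} A) :
    Convergence ((lerayFunctor A).obj c) fun n => (homology n).obj c.left :=
  .ofBottomRow (limitTermBottomRowIso _) (isZero_limitTerm_bottomRow _)

variable {A}

theorem lerayConvergence_compatible {c c' : MapWithCoeff.{w, v, u} A} (m : c ⟶ c') :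
    (lerayConvergence A c).Compatible (lerayConvergence A c') ((lerayFunctor A).map m)
      fun n => (homology n).map m.left :=
  Convergence.ofBottomRow_compatible _ _ _ _ _ _
    (limitTermBottomRowIso_naturality ((gradedHomology A).map m.left))

variable (S : ∀ {X Y : SSet.{u}} (f : X ⟶ Y), LeftSatellites (lan A f))

/-- The morphism of natural systems `(X, T) ⟶ (Y, L_0 Lan_f T)` over `f : X ⟶ Y`. -/
noncomputable def toSatelliteSystem (c : MapWithCoeff.{w, v, u} A) :
    c.left ⟶ satelliteSystem S 0 c :=
  NatSystem.Hom.mk c.f ((satelliteUnit (S c.f)).app c.left.T)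

theorem isIso_homology_map_toSatelliteSystem (c : MapWithCoeff.{w, v, u} A) (p : ℕ) :
    IsIso ((homology p).map (toSatelliteSystem S c)) :=
  have : (satelliteSystem S 0 c).T.IsLeftKanExtension (toSatelliteSystem S c).τ :=
    isLeftKanExtension_satelliteUnit (S c.f) c.left.T
  isIso_homology_map (toSatelliteSystem S c) p

theorem toSatelliteSystem_naturality {c c' : MapWithCoeff.{w, v, u} A} (m : c ⟶ c')
    (κ : SatelliteComparison (S c.f) (S c'.f) m.left.φ m.right m.w) :
    m.left ≫ toSatelliteSystem S c' = toSatelliteSystem S c ≫ satelliteSystemMap S 0 m κ := by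
  refine NatSystem.hom_ext_of_natTrans (opSimplicesSquareIso _ _ _ _ m.w).hom (fun _ => rfl) ?_
  have unit_naturality := (satelliteUnit (S c.f)).naturality m.left.τ
  have zero := satelliteUnit_comp_zero_app κ c'.left.T
  change (m.left.τ ≫ (res A m.left.φ).map ((satelliteUnit (S c'.f)).app c'.left.T)) ≫
      (resSquareIso A c.f c'.f m.left.φ m.right m.w).hom.app (((S c'.f).L 0).obj c'.left.T) =
    (satelliteUnit (S c.f)).app c.left.T ≫
      (res A c.f).map (((S c.f).L 0).map m.left.τ ≫ κ.zero.app c'.left.T)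
  rw [Category.assoc, ← zero, Functor.map_comp]
  exact (Category.assoc _ _ _).symm.trans
    ((congrArg (· ≫ _) unit_naturality).trans (Category.assoc _ _ _))

/-- The isomorphism `H_p(X, T) ≅ H_p(Y, L_0 Lan_f T)` induced by `f : X ⟶ Y`. -/
noncomputable def homologyIsoSatelliteSystem (c : MapWithCoeff.{w, v, u} A) (p : ℕ) :
    (homology p).obj c.left ≅ (homology p).obj (satelliteSystem S 0 c) :=
  have := isIso_homology_map_toSatelliteSystem S c p
  asIso ((homology p).map (toSatelliteSystem S c))

theorem homologyIsoSatelliteSystem_naturality {c c' : MapWithCoeff.{w, v, u} A} (m : c ⟶ c')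
    (κ : SatelliteComparison (S c.f) (S c'.f) m.left.φ m.right m.w) (p : ℕ) :
    (homology p).map m.left ≫ (homologyIsoSatelliteSystem S c' p).hom =
      (homologyIsoSatelliteSystem S c p).hom ≫ (homology p).map (satelliteSystemMap S 0 m κ) :=
  ((homology p).map_comp _ _).symm.trans <|
    (congrArg (homology p).map (toSatelliteSystem_naturality S m κ)).trans
      ((homology p).map_comp _ _)

variable [AB4OfSize.{u} A]

theorem isZero_homology_satelliteSystem (c : MapWithCoeff.{w, v, u} A) (p q : ℕ) :
    IsZero ((homology p).obj (satelliteSystem S (q + 1) c)) :=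
  isZero_homology (S := satelliteSystem S (q + 1) c)
    (((S c.f).isZero_L_succ q).obj c.left.T) p

/-- The identification of the second page of the Leray spectral sequence. -/
noncomputable def lerayIso (c : MapWithCoeff.{w, v, u} A) (p : ℕ) : ∀ q : ℕ,
    ((lerayFunctor A).obj c).secondPage p q ≅ (homology p).obj (satelliteSystem S q c)
  | 0 => secondPageBottomRowIso ((gradedHomology A).obj c.left) p ≪≫
      homologyIsoSatelliteSystem S c p
  | q + 1 => (isZero_secondPage_bottomRow _ p q).iso
      (isZero_homology_satelliteSystem S c p q)

theorem lerayIso_naturality {c c' : MapWithCoeff.{w, v, u} A} (m : c ⟶ c')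
    (κ : SatelliteComparison (S c.f) (S c'.f) m.left.φ m.right m.w) (p : ℕ) : ∀ q : ℕ,
    secondPageMap ((lerayFunctor A).map m) p q ≫ (lerayIso S c' p q).hom =
      (lerayIso S c p q).hom ≫ (homology p).map (satelliteSystemMap S q m κ)
  | 0 =>
    have row := CommSq.mk (secondPageBottomRowIso_naturality ((gradedHomology A).map m.left) p)
    (row.vert_comp ⟨homologyIsoSatelliteSystem_naturality S m κ p⟩).w
  | q + 1 => (isZero_homology_satelliteSystem S c' p q).eq_of_tgt _ _

end Leray

end GabrielZisman

/-- The Leray type homology spectral sequence.  First, the left satellites `L_q ((Δ/f)ᵒᵖ)_*` of the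
left Kan extension along `(Δ/f)ᵒᵖ` exist for every map `f` of simplicial sets.  Moreover, for every
choice `S` of them, they depend naturally on `f` through unique comparison maps `κ`, and there is a
functor `E` from maps `f : X ⟶ Y` with coefficients `T : (Δ/X)ᵒᵖ ⥤ A` to first quadrant homology
spectral sequences with `E^2_{p,q} ≅ H_p^{GZ}(Y, L_q ((Δ/f)ᵒᵖ)_* T) ⇒ H_{p+q}^{GZ}(X, T)`, naturally
in `f` and `T`. -/
theorem mainTheorem2 (A : Type w) [Category.{v} A] [Abelian A] [HasColimitsOfSize.{u, u} A]
    [AB4OfSize.{u} A] :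
    (∀ {X Y : SSet.{u}} (f : X ⟶ Y), Nonempty (LeftSatellites (GabrielZisman.lan A f))) ∧
    ∀ (S : ∀ {X Y : SSet.{u}} (f : X ⟶ Y), LeftSatellites (GabrielZisman.lan A f)),
      ∃ κ : ∀ {X Y X' Y' : SSet.{u}} {f : X ⟶ Y} {f' : X' ⟶ Y'} (g : X ⟶ X') (h : Y ⟶ Y')
          (w : g ≫ f' = f ≫ h), GabrielZisman.SatelliteComparison (S f) (S f') g h w,
        (∀ {X Y X' Y' : SSet.{u}} {f : X ⟶ Y} {f' : X' ⟶ Y'} (g : X ⟶ X') (h : Y ⟶ Y')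
          (w : g ≫ f' = f ≫ h) (κ' : GabrielZisman.SatelliteComparison (S f) (S f') g h w),
          κ' = κ g h w) ∧
        ∃ (E : GabrielZisman.MapWithCoeff.{w, v, u} A ⥤ E2HomologicalSpectralSequenceNat A)
          (e : ∀ (c : GabrielZisman.MapWithCoeff.{w, v, u} A) (p q : ℕ),
            (E.obj c).secondPage p q ≅
              (GabrielZisman.homology p).obj (GabrielZisman.satelliteSystem S q c))
          (conv : ∀ c : GabrielZisman.MapWithCoeff.{w, v, u} A,
            Convergence (E.obj c) (fun n => (GabrielZisman.homology n).obj c.left)),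
          (∀ {c c' : GabrielZisman.MapWithCoeff.{w, v, u} A} (m : c ⟶ c') (p q : ℕ),
            E2HomologicalSpectralSequenceNat.secondPageMap (E.map m) p q ≫ (e c' p q).hom =
              (e c p q).hom ≫ (GabrielZisman.homology p).map
                (GabrielZisman.satelliteSystemMap S q m (κ m.left.φ m.right m.w))) ∧
          (∀ {c c' : GabrielZisman.MapWithCoeff.{w, v, u} A} (m : c ⟶ c'),
            (conv c).Compatible (conv c') (E.map m)
              (fun n => (GabrielZisman.homology n).map m.left)) := by
  refine ⟨fun f => ⟨.ofPreservesMonomorphisms (GabrielZisman.lan A f)⟩, fun S => ?_⟩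
  refine ⟨fun _ _ _ => Classical.arbitrary _, fun _ _ _ _ => Subsingleton.elim _ _,
    GabrielZisman.lerayFunctor A, GabrielZisman.lerayIso S, GabrielZisman.lerayConvergence A,
    fun m p q => ?_, fun m => ?_⟩
  · exact GabrielZisman.lerayIso_naturality S m _ p q
  · exact GabrielZisman.lerayConvergence_compatible m
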